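/- Let $\mathcal H$ be a complex Hilbert space and let $A,B,C,D$ be bounded linear operators on $\mathcal H$. For a bounded linear operator $T$ on $\mathcal H$ let $T^*$ be its adjoint, $|T|=(T^*T)^{1/2}$, $\|T\|$ its operator norm and $w(T)=\sup\{|\langle Tx,x\rangle| : x\in\mathcal H,\ \|x\|=1\}$ its numerical radius; for $s\ge 0$ the power $|T|^{s}$ is given by the continuous functional calculus, with $|T|^{0}=I$. Then, for each of the two choices of the sign, $$ w(AB\pm CD)\le \frac14\Big(\inf_{t\in[0,1]}\big\||A|^{2t}+|B^*|^{2t}\big\|\,\big\||A^*|^{2(1-t)}+|B|^{2(1-t)}\big\| +\inf_{t\in[0,1]}\big\||C|^{2t}+|D^*|^{2t}\big\|\,\big\||C^*|^{2(1-t)}+|D|^{2(1-t)}\big\|\Big). $$ -/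

import Mathlib

/-- The numerical radius `w(T) = sup {|⟨T x, x⟩| : ‖x‖ = 1}` of a bounded operator. The set is
bounded above by `‖T‖`; on the zero space it is empty and the value is `0`. -/
noncomputable def numericalRadius {H : Type*} [NormedAddCommGroup H] [InnerProductSpace ℂ H]
    (T : H →L[ℂ] H) : ℝ :=
  sSup {r : ℝ | ∃ x : H, ‖x‖ = 1 ∧ r = ‖inner ℂ (T x) x‖}

theorem numericalRadius_bddAbove {H : Type*} [NormedAddCommGroup H] [InnerProductSpace ℂ H]
    (T : H →L[ℂ] H) : BddAbove {r : ℝ | ∃ x : H, ‖x‖ = 1 ∧ r = ‖inner ℂ (T x) x‖} := by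
  refine ⟨‖T‖, ?_⟩
  rintro r ⟨x, hx, rfl⟩
  have h1 := norm_inner_le_norm (𝕜 := ℂ) (T x) x
  have h2 := T.le_opNorm x
  rw [hx, mul_one] at h1 h2
  exact h1.trans h2

/-! For a unit vector `x`, `⟨ABx, x⟩ = ⟨Bx, A*x⟩`. With a unimodular `c` making `⟨cBx, A*x⟩` equal
to its modulus, polarization bounds that modulus by `‖y‖² / 4`, where `y = cBx + A*x`. Expanding
`⟨y, y⟩` gives `‖y‖² ≤ |⟨A*x, y⟩| + |⟨Bx, y⟩|`. Kato's inequality for both terms, combined by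
Cauchy–Schwarz in `ℝ²`, bounds the square of the right side by `M N ‖y‖²`, where `M`, `N` are the
two norms in the claim; hence `‖y‖² ≤ M N`. The triangle inequality treats `AB` and `CD` separately,
so each has its own infimum.

Kato's inequality rests on `T (T*T) = (TT*) T`, which lets powers of `T*T` pass through `T`. -/

/-- If `x` intertwines the self-adjoint elements `a` and `b`, then it intertwines every continuous
function of them. -/
theorem SemiconjBy.cfc_real {A : Type*} [Ring A] [StarRing A] [Algebra ℝ A] [TopologicalSpace A]
    [ContinuousFunctionalCalculus ℝ A IsSelfAdjoint] [IsTopologicalRing A] [T2Space A]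
    {x a b : A} (h : SemiconjBy x a b) (ha : IsSelfAdjoint a) (hb : IsSelfAdjoint b)
    (f : ℝ → ℝ) (hf : ContinuousOn f (spectrum ℝ a ∪ spectrum ℝ b)) :
    SemiconjBy x (cfc f a) (cfc f b) := by
  have hca : IsCompact (spectrum ℝ a) := ContinuousFunctionalCalculus.isCompact_spectrum a
  have hcb : IsCompact (spectrum ℝ b) := ContinuousFunctionalCalculus.isCompact_spectrum b
  have : CompactSpace ↑(spectrum ℝ a ∪ spectrum ℝ b) :=
    isCompact_iff_compactSpace.mp (hca.union hcb)
  have hsa : spectrum ℝ a ⊆ spectrum ℝ a ∪ spectrum ℝ b := Set.subset_union_left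
  have hsb : spectrum ℝ b ⊆ spectrum ℝ a ∪ spectrum ℝ b := Set.subset_union_right
  -- On the union of the spectra one function serves both calculi, so Stone–Weierstrass induction
  -- applies.
  have key : ∀ g : C(↑(spectrum ℝ a ∪ spectrum ℝ b), ℝ),
      SemiconjBy x (cfcHomSuperset ha hsa g) (cfcHomSuperset hb hsb g) := by
    intro g
    induction g using ContinuousMap.induction_on_of_compact with
    | const r =>
      have hr : ContinuousMap.const (↑(spectrum ℝ a ∪ spectrum ℝ b)) r = algebraMap ℝ _ r := rfl
      rw [hr, AlgHomClass.commutes, AlgHomClass.commutes]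
      exact Algebra.commute_algebraMap_right r x
    | id => rwa [cfcHomSuperset_id, cfcHomSuperset_id]
    | star_id =>
      rwa [map_star, map_star, cfcHomSuperset_id, cfcHomSuperset_id, ha.star_eq, hb.star_eq]
    | add f g hf hg => rw [map_add, map_add]; exact hf.add_right hg
    | mul f g hf hg => rw [map_mul, map_mul]; exact hf.mul_right hg
    | frequently f hf =>
      have hcl : IsClosed {g : C(↑(spectrum ℝ a ∪ spectrum ℝ b), ℝ) |
          x * cfcHomSuperset ha hsa g = cfcHomSuperset hb hsb g * x} :=
        isClosed_eq (continuous_const.mul (cfcHomSuperset_continuous ha hsa))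
          ((cfcHomSuperset_continuous hb hsb).mul continuous_const)
      exact hcl.closure_subset (mem_closure_iff_frequently.mpr hf)
  rw [cfc_apply f a ha (hf.mono hsa), cfc_apply f b hb (hf.mono hsb)]
  exact key ⟨_, hf.domRestrict⟩

/-! ### Scalar powers and their shifts by `ε` -/

theorem Real.mul_add_rpow_neg_le_rpow {s t u ε : ℝ} (hs : 0 ≤ s) (hst : s + t = 1)
    (hu : 0 ≤ u) (hε : 0 < ε) : u * (u + ε) ^ (-s) ≤ u ^ t := by
  rcases hu.eq_or_lt with rfl | hu
  · simpa using Real.rpow_nonneg le_rfl t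
  · calc u * (u + ε) ^ (-s) ≤ u * u ^ (-s) := by
          gcongr u * ?_
          exact Real.rpow_le_rpow_of_nonpos hu (by linarith) (by linarith)
      _ = u ^ t := by
          rw [show t = 1 + -s by linarith, Real.rpow_add hu, Real.rpow_one]

/-- Subadditivity of `u ^ s` makes `ε = δ ^ s⁻¹` work uniformly in `u`. -/
theorem Real.exists_add_rpow_le_rpow_add {s δ : ℝ} (hs : 0 ≤ s) (hs1 : s ≤ 1) (hδ : 0 < δ) :
    ∃ ε > 0, ∀ u : ℝ, 0 ≤ u → (u + ε) ^ s ≤ u ^ s + δ := by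
  rcases hs.eq_or_lt with rfl | hs0
  · exact ⟨1, one_pos, fun u _ => by simp [hδ.le]⟩
  · refine ⟨δ ^ s⁻¹, Real.rpow_pos_of_pos hδ _, fun u hu => ?_⟩
    have := Real.rpow_add_le_add_rpow hu (Real.rpow_nonneg hδ.le s⁻¹) hs hs1
    rwa [Real.rpow_inv_rpow hδ.le hs0.ne'] at this

theorem CFC.abs_rpow_two_mul {A : Type*} [CStarAlgebra A] [PartialOrder A] [StarOrderedRing A]
    (a : A) {t : ℝ} (ht : 0 ≤ t) :
    CFC.abs a ^ (2 * t) = cfc (fun u : ℝ => u ^ t) (star a * a) := by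
  rw [← CFC.rpow_eq_cfc_real (star_mul_self_nonneg a)]
  have h := CFC.rpow_sqrt_nnreal (a := star a * a) (x := ⟨2 * t, by positivity⟩)
    (star_mul_self_nonneg a)
  change CFC.abs a ^ (2 * t) = (star a * a) ^ (2 * t / 2) at h
  rwa [mul_div_cancel_left₀ t two_ne_zero] at h

section HilbertSpace

variable {H : Type*} [NormedAddCommGroup H] [InnerProductSpace ℂ H]

theorem ContinuousLinearMap.re_inner_apply_self_mono {S T : H →L[ℂ] H} (h : S ≤ T) (x : H) :
    (inner ℂ (S x) x).re ≤ (inner ℂ (T x) x).re := by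
  have := ((ContinuousLinearMap.le_def S T).mp h).re_inner_nonneg_left x
  simpa [inner_sub_left] using this

theorem ContinuousLinearMap.re_inner_apply_self_le (T : H →L[ℂ] H) (x : H) :
    (inner ℂ (T x) x).re ≤ ‖T‖ * ‖x‖ ^ 2 :=
  calc (inner ℂ (T x) x).re ≤ ‖T x‖ * ‖x‖ := re_inner_le_norm (𝕜 := ℂ) _ _
    _ ≤ ‖T‖ * ‖x‖ * ‖x‖ := by gcongr; exact T.le_opNorm x
    _ = ‖T‖ * ‖x‖ ^ 2 := by ring

theorem four_mul_re_inner_le_norm_add_sq (u v : H) :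
    4 * (inner ℂ u v).re ≤ ‖u + v‖ ^ 2 := by
  have h1 := norm_add_sq (𝕜 := ℂ) u v
  have h2 := norm_sub_sq (𝕜 := ℂ) u v
  have h3 := sq_nonneg ‖u - v‖
  simp only [RCLike.re_eq_complex_re] at h1 h2
  linarith

theorem numericalRadius_le {T : H →L[ℂ] H} {r : ℝ} (hr : 0 ≤ r)
    (h : ∀ x : H, ‖x‖ = 1 → ‖inner ℂ (T x) x‖ ≤ r) : numericalRadius T ≤ r :=
  Real.sSup_le (by rintro _ ⟨x, hx, rfl⟩; exact h x hx) hr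

variable [CompleteSpace H]

theorem ContinuousLinearMap.norm_apply_sq_eq_re_inner (T : H →L[ℂ] H) (x : H) :
    ‖T x‖ ^ 2 = (inner ℂ ((star T * T) x) x).re :=
  T.apply_norm_sq_eq_inner_adjoint_left x

/-- **Kato's mixed Schwarz inequality**. -/
theorem ContinuousLinearMap.norm_inner_sq_le_abs_rpow (T : H →L[ℂ] H) {t : ℝ}
    (ht : t ∈ Set.Icc (0 : ℝ) 1) (x y : H) :
    ‖inner ℂ (T x) y‖ ^ 2 ≤ (inner ℂ ((CFC.abs T ^ (2 * t)) x) x).re *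
      (inner ℂ ((CFC.abs (star T) ^ (2 * (1 - t))) y) y).re := by
  obtain ⟨ht0, ht1⟩ := ht
  have hs0 : 0 ≤ 1 - t := by linarith
  rw [CFC.abs_rpow_two_mul T ht0, CFC.abs_rpow_two_mul (star T) hs0, star_star]
  set a := star T * T with ha_def
  set b := T * star T with hb_def
  have ha : 0 ≤ a := star_mul_self_nonneg T
  have hb : 0 ≤ b := mul_star_self_nonneg T
  have ha' : IsSelfAdjoint a := ha.isSelfAdjoint
  have hb' : IsSelfAdjoint b := hb.isSelfAdjoint
  have hsa : ∀ u ∈ spectrum ℝ a, 0 ≤ u := fun u hu => spectrum_nonneg_of_nonneg ha hu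
  have hsb : ∀ u ∈ spectrum ℝ b, 0 ≤ u := fun u hu => spectrum_nonneg_of_nonneg hb hu
  have hpow : ∀ {r : ℝ}, 0 ≤ r → Continuous fun u : ℝ => u ^ r :=
    fun hr => Real.continuous_rpow_const hr
  set P := (inner ℂ (cfc (fun u : ℝ => u ^ t) a x) x).re
  set Q := (inner ℂ (cfc (fun u : ℝ => u ^ (1 - t)) b y) y).re
  have hP : 0 ≤ P := by
    have h0 : 0 ≤ cfc (fun u : ℝ => u ^ t) a :=
      cfc_nonneg fun u hu => Real.rpow_nonneg (hsa u hu) t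
    simpa using ContinuousLinearMap.re_inner_apply_self_mono h0 x
  -- Formally `T = b ^ ((1 - t) / 2) T a ^ (-(1 - t) / 2)`, and Cauchy–Schwarz would finish. As `a`
  -- need not be invertible, both powers are shifted by `ε`, at a cost of `δ ‖y‖²` that vanishes in
  -- the limit.
  have main : ∀ δ > 0, ‖inner ℂ (T x) y‖ ^ 2 ≤ P * (Q + δ * ‖y‖ ^ 2) := by
    intro δ hδ
    obtain ⟨ε, hε, hεδ⟩ := Real.exists_add_rpow_le_rpow_add hs0 (by linarith) hδ
    have hcont : ∀ r : ℝ, ContinuousOn (fun u : ℝ => (u + ε) ^ r)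
        (spectrum ℝ a ∪ spectrum ℝ b) := by
      intro r
      refine ContinuousOn.rpow_const (by fun_prop) fun u hu => Or.inl ?_
      have : 0 ≤ u := hu.elim (hsa u) (hsb u)
      positivity
    have hconta := fun r => (hcont r).mono Set.subset_union_left
    have hcontb := fun r => (hcont r).mono Set.subset_union_right
    let f : ℝ → ℝ := fun u => (u + ε) ^ (-((1 - t) / 2))
    let g : ℝ → ℝ := fun u => (u + ε) ^ ((1 - t) / 2)
    have hcomm : T * cfc f a = cfc f b * T :=
      SemiconjBy.cfc_real (show T * a = b * T by rw [ha_def, hb_def, mul_assoc]) ha' hb' f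
        (hcont _)
    have hfg : cfc g b * cfc f b = 1 := by
      rw [← cfc_mul g f b (hcontb _) (hcontb _), ← cfc_one ℝ b]
      refine cfc_congr fun u hu => ?_
      have : 0 < u + ε := add_pos_of_nonneg_of_pos (hsb u hu) hε
      simp only [f, g, Pi.one_apply]
      rw [← Real.rpow_add this, add_neg_cancel, Real.rpow_zero]
    have hfsa : star (cfc f a) = cfc f a := (cfc_predicate f a : IsSelfAdjoint _).star_eq
    have hgsa : star (cfc g b) = cfc g b := (cfc_predicate g b : IsSelfAdjoint _).star_eq
    have hinner : inner ℂ (T x) y = inner ℂ ((T * cfc f a) x) (cfc g b y) := by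
      have h1 : (cfc g b) ((T * cfc f a) x) = T x := by
        rw [hcomm, ← mul_apply_eq_comp, ← mul_assoc, hfg, one_mul]
      rw [← ContinuousLinearMap.adjoint_inner_left, ← ContinuousLinearMap.star_eq_adjoint, hgsa,
        h1]
    have hx : ‖(T * cfc f a) x‖ ^ 2 ≤ P := by
      rw [ContinuousLinearMap.norm_apply_sq_eq_re_inner]
      refine ContinuousLinearMap.re_inner_apply_self_mono ?_ x
      have h2 : star (T * cfc f a) * (T * cfc f a) = cfc (fun u => f u * (u * f u)) a := by
        rw [cfc_mul f (fun u => u * f u) a (hconta _) (continuousOn_id.mul (hconta _)),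
          cfc_mul (fun u => u) f a continuousOn_id (hconta _), cfc_id' ℝ a, star_mul, hfsa]
        simp only [ha_def, mul_assoc]
      rw [h2]
      refine cfc_mono (fun u hu => ?_)
        ((hconta _).mul (continuousOn_id.mul (hconta _))) (hpow ht0).continuousOn
      have hu0 := hsa u hu
      have hpos : 0 < u + ε := by positivity
      have h3 : f u * f u = (u + ε) ^ (-(1 - t)) := by
        simp only [f]
        rw [← Real.rpow_add hpos]
        congr 1; ring
      calc f u * (u * f u) = u * (u + ε) ^ (-(1 - t)) := by rw [← h3]; ring
        _ ≤ u ^ t := Real.mul_add_rpow_neg_le_rpow hs0 (by ring) hu0 hε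
    have hy : ‖cfc g b y‖ ^ 2 ≤ Q + δ * ‖y‖ ^ 2 := by
      rw [ContinuousLinearMap.norm_apply_sq_eq_re_inner, hgsa,
        ← cfc_mul g g b (hcontb _) (hcontb _)]
      have h4 : cfc (fun u => g u * g u) b ≤ cfc (fun u : ℝ => u ^ (1 - t)) b + algebraMap ℝ _ δ := by
        rw [← cfc_add_const δ _ b (hpow hs0).continuousOn]
        refine cfc_mono (fun u hu => ?_) ((hcontb _).mul (hcontb _))
          ((hpow hs0).continuousOn.add continuousOn_const)
        have hpos : 0 < u + ε := add_pos_of_nonneg_of_pos (hsb u hu) hε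
        simp only [g]
        rw [← Real.rpow_add hpos, add_halves]
        exact hεδ u (hsb u hu)
      refine (ContinuousLinearMap.re_inner_apply_self_mono h4 y).trans_eq ?_
      have h5 : (algebraMap ℝ (H →L[ℂ] H) δ) y = (δ : ℂ) • y := by
        simp [Algebra.algebraMap_eq_smul_one]
      rw [add_apply, inner_add_left, Complex.add_re, h5, inner_smul_left,
        inner_self_eq_norm_sq_to_K]
      simp [Q, ← Complex.ofReal_pow]
    calc ‖inner ℂ (T x) y‖ ^ 2 ≤ (‖(T * cfc f a) x‖ * ‖cfc g b y‖) ^ 2 := by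
          rw [hinner]; gcongr; exact norm_inner_le_norm _ _
      _ = ‖(T * cfc f a) x‖ ^ 2 * ‖cfc g b y‖ ^ 2 := mul_pow _ _ _
      _ ≤ P * (Q + δ * ‖y‖ ^ 2) := by gcongr
  have hlim : Filter.Tendsto (fun δ : ℝ => P * (Q + δ * ‖y‖ ^ 2)) (nhdsWithin 0 (Set.Ioi 0))
      (nhds (P * Q)) := by
    have : Continuous fun δ : ℝ => P * (Q + δ * ‖y‖ ^ 2) := by fun_prop
    simpa using (this.tendsto 0).mono_left nhdsWithin_le_nhds
  exact ge_of_tendsto hlim (eventually_nhdsWithin_of_forall fun δ hδ => main δ hδ)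

theorem ContinuousLinearMap.re_inner_rpow_nonneg (T : H →L[ℂ] H) (r : ℝ) (x : H) :
    0 ≤ (inner ℂ ((T ^ r) x) x).re := by
  simpa using ContinuousLinearMap.re_inner_apply_self_mono (CFC.rpow_nonneg (a := T) (y := r)) x

/-- A form of the mixed Schwarz inequality for the sum of two operators. -/
theorem ContinuousLinearMap.norm_inner_add_norm_inner_sq_le (S T : H →L[ℂ] H) {t : ℝ}
    (ht : t ∈ Set.Icc (0 : ℝ) 1) (x y : H) :
    (‖inner ℂ (S x) y‖ + ‖inner ℂ (T x) y‖) ^ 2 ≤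
      ‖CFC.abs S ^ (2 * t) + CFC.abs T ^ (2 * t)‖ * ‖x‖ ^ 2 *
        (‖CFC.abs (star S) ^ (2 * (1 - t)) + CFC.abs (star T) ^ (2 * (1 - t))‖ * ‖y‖ ^ 2) := by
  have hS := S.norm_inner_sq_le_abs_rpow ht x y
  have hT := T.norm_inner_sq_le_abs_rpow ht x y
  have hx := ContinuousLinearMap.re_inner_apply_self_le
    (CFC.abs S ^ (2 * t) + CFC.abs T ^ (2 * t)) x
  have hy := ContinuousLinearMap.re_inner_apply_self_le
    (CFC.abs (star S) ^ (2 * (1 - t)) + CFC.abs (star T) ^ (2 * (1 - t))) y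
  rw [add_apply, inner_add_left, Complex.add_re] at hx hy
  have h1 := (CFC.abs S).re_inner_rpow_nonneg (2 * t) x
  have h2 := (CFC.abs T).re_inner_rpow_nonneg (2 * t) x
  have h3 := (CFC.abs (star S)).re_inner_rpow_nonneg (2 * (1 - t)) y
  have h4 := (CFC.abs (star T)).re_inner_rpow_nonneg (2 * (1 - t)) y
  refine le_trans ?_ (mul_le_mul hx hy (add_nonneg h3 h4) ((add_nonneg h1 h2).trans hx))
  generalize (inner ℂ ((CFC.abs S ^ (2 * t)) x) x).re = p at *
  generalize (inner ℂ ((CFC.abs T ^ (2 * t)) x) x).re = q at *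
  generalize (inner ℂ ((CFC.abs (star S) ^ (2 * (1 - t))) y) y).re = p' at *
  generalize (inner ℂ ((CFC.abs (star T) ^ (2 * (1 - t))) y) y).re = q' at *
  have hu := norm_nonneg (inner ℂ (S x) y)
  have hv := norm_nonneg (inner ℂ (T x) y)
  generalize ‖inner ℂ (S x) y‖ = u at *
  generalize ‖inner ℂ (T x) y‖ = v at *
  -- AM–GM: `u v` is at most the geometric mean of `p q'` and `q p'`.
  have huv : 2 * (u * v) ≤ p * q' + q * p' := by
    refine abs_le_of_sq_le_sq' ?_ (by positivity) |>.2
    have : u ^ 2 * v ^ 2 ≤ (p * p') * (q * q') := by gcongr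
    nlinarith [sq_nonneg (p * q' - q * p')]
  nlinarith

theorem ContinuousLinearMap.norm_inner_mul_apply_self_le (A B : H →L[ℂ] H) {t : ℝ}
    (ht : t ∈ Set.Icc (0 : ℝ) 1) {x : H} (hx : ‖x‖ = 1) :
    ‖inner ℂ ((A * B) x) x‖ ≤ 1 / 4 *
      (‖CFC.abs A ^ (2 * t) + CFC.abs (star B) ^ (2 * t)‖ *
        ‖CFC.abs (star A) ^ (2 * (1 - t)) + CFC.abs B ^ (2 * (1 - t))‖) := by
  have hz : inner ℂ ((A * B) x) x = inner ℂ (B x) (star A x) := by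
    rw [ContinuousLinearMap.star_eq_adjoint, ContinuousLinearMap.adjoint_inner_right]; rfl
  rw [hz]
  obtain ⟨c, hc, hcz⟩ : ∃ c : ℂ, ‖c‖ = 1 ∧
      (inner ℂ (c • B x) (star A x)).re = ‖inner ℂ (B x) (star A x)‖ := by
    obtain ⟨c, hc, h⟩ := Complex.exists_norm_eq_mul_self (inner ℂ (B x) (star A x))
    -- The inner product is conjugate-linear in its first slot, hence `star c`.
    refine ⟨star c, by rwa [norm_star], ?_⟩
    rw [inner_smul_left, starRingEnd_apply, star_star, ← h, Complex.ofReal_re]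
  set y := c • B x + star A x with hy
  have h4 := four_mul_re_inner_le_norm_add_sq (c • B x) (star A x)
  rw [hcz, ← hy] at h4
  -- For the pair `A*`, `B`, the exponent `1 - t` puts `N` on the `x` side and `M` on the `y` side.
  have hs : (1 : ℝ) - t ∈ Set.Icc (0 : ℝ) 1 := ⟨by linarith [ht.2], by linarith [ht.1]⟩
  have hM := ContinuousLinearMap.norm_inner_add_norm_inner_sq_le (star A) B hs x y
  rw [star_star, sub_sub_cancel, hx, one_pow, mul_one] at hM
  set M := ‖CFC.abs A ^ (2 * t) + CFC.abs (star B) ^ (2 * t)‖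
  set N := ‖CFC.abs (star A) ^ (2 * (1 - t)) + CFC.abs B ^ (2 * (1 - t))‖
  have hyy : ‖y‖ ^ 2 ≤ ‖inner ℂ (star A x) y‖ + ‖inner ℂ (B x) y‖ := by
    have h1 : (inner ℂ y y : ℂ) = inner ℂ (c • B x) y + inner ℂ (star A x) y := by
      rw [← inner_add_left]
    have h2 : ‖inner ℂ y y‖ = ‖y‖ ^ 2 := by
      rw [inner_self_eq_norm_sq_to_K]; simp
    rw [← h2, h1, add_comm]
    refine (norm_add_le _ _).trans_eq ?_
    rw [inner_smul_left, norm_mul, RCLike.norm_conj, hc, one_mul]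
  have hle : ‖y‖ ^ 2 ≤ M * N := by
    -- Cancelling `‖y‖²` needs `y ≠ 0`.
    rcases (norm_nonneg y).eq_or_lt with h0 | h0
    · simpa [← h0] using mul_nonneg (norm_nonneg _) (norm_nonneg _)
    · have h5 : (‖y‖ ^ 2) ^ 2 ≤ N * (M * ‖y‖ ^ 2) := (pow_le_pow_left₀ (by positivity) hyy 2).trans hM
      have h6 : 0 < ‖y‖ ^ 2 := by positivity
      nlinarith
  linarith

end HilbertSpace

theorem theorem2p14 {H : Type*} [NormedAddCommGroup H] [InnerProductSpace ℂ H] [CompleteSpace H]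
    (A B C D : H →L[ℂ] H) :
    numericalRadius (A * B + C * D) ≤
        1 / 4 *
          ((⨅ t : Set.Icc (0 : ℝ) 1,
              ‖CFC.abs A ^ (2 * (t : ℝ)) + CFC.abs (star B) ^ (2 * (t : ℝ))‖ *
                ‖CFC.abs (star A) ^ (2 * (1 - (t : ℝ))) + CFC.abs B ^ (2 * (1 - (t : ℝ)))‖) +
            ⨅ t : Set.Icc (0 : ℝ) 1,
              ‖CFC.abs C ^ (2 * (t : ℝ)) + CFC.abs (star D) ^ (2 * (t : ℝ))‖ *
                ‖CFC.abs (star C) ^ (2 * (1 - (t : ℝ))) + CFC.abs D ^ (2 * (1 - (t : ℝ)))‖) ∧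
      numericalRadius (A * B - C * D) ≤
        1 / 4 *
          ((⨅ t : Set.Icc (0 : ℝ) 1,
              ‖CFC.abs A ^ (2 * (t : ℝ)) + CFC.abs (star B) ^ (2 * (t : ℝ))‖ *
                ‖CFC.abs (star A) ^ (2 * (1 - (t : ℝ))) + CFC.abs B ^ (2 * (1 - (t : ℝ)))‖) +
            ⨅ t : Set.Icc (0 : ℝ) 1,
              ‖CFC.abs C ^ (2 * (t : ℝ)) + CFC.abs (star D) ^ (2 * (t : ℝ))‖ *
                ‖CFC.abs (star C) ^ (2 * (1 - (t : ℝ))) + CFC.abs D ^ (2 * (1 - (t : ℝ)))‖) := by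
  have key : ∀ (A B : H →L[ℂ] H) (x : H), ‖x‖ = 1 → ‖inner ℂ ((A * B) x) x‖ ≤ 1 / 4 *
      ⨅ t : Set.Icc (0 : ℝ) 1, ‖CFC.abs A ^ (2 * (t : ℝ)) + CFC.abs (star B) ^ (2 * (t : ℝ))‖ *
        ‖CFC.abs (star A) ^ (2 * (1 - (t : ℝ))) + CFC.abs B ^ (2 * (1 - (t : ℝ)))‖ := by
    intro A B x hx
    rw [Real.mul_iInf_of_nonneg (by norm_num)]
    exact le_ciInf fun t => A.norm_inner_mul_apply_self_le B t.2 hx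
  have hnonneg : ∀ A B : H →L[ℂ] H, 0 ≤ ⨅ t : Set.Icc (0 : ℝ) 1,
      ‖CFC.abs A ^ (2 * (t : ℝ)) + CFC.abs (star B) ^ (2 * (t : ℝ))‖ *
        ‖CFC.abs (star A) ^ (2 * (1 - (t : ℝ))) + CFC.abs B ^ (2 * (1 - (t : ℝ)))‖ :=
    fun A B => Real.iInf_nonneg fun t => by positivity
  have hrhs := mul_nonneg (by norm_num : (0 : ℝ) ≤ 1 / 4) (add_nonneg (hnonneg A B) (hnonneg C D))
  refine ⟨numericalRadius_le hrhs fun x hx => ?_, numericalRadius_le hrhs fun x hx => ?_⟩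
  · rw [add_apply, inner_add_left, mul_add]
    exact (norm_add_le _ _).trans (add_le_add (key A B x hx) (key C D x hx))
  · rw [sub_apply, inner_sub_left, mul_add]
    exact (norm_sub_le _ _).trans (add_le_add (key A B x hx) (key C D x hx))
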